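/- Let $\mathcal X$ be a metric space with its Borel $\sigma$-algebra, let $\mathcal Y\subset\mathbb R$ be closed, and let $\mathcal X_1,\dots,\mathcal X_B\subset\mathcal X$ be subsets (regions, not necessarily disjoint) each of which is a complete separable metric space. Let $w_1,\dots,w_B:\mathcal X\to[0,1]$ be measurable with $\sum_{b=1}^B w_b(x)=1$ for all $x\in\mathcal X$ and $w_b(x)=0$ for all $x\notin\mathcal X_b$. For each $b$ let $H_b$ be the RKHS on $\mathcal X_b$ of a bounded and continuous real kernel $k_b$ (bounded: $\sup_{x\in\mathcal X_b}\sqrt{k_b(x,x)}<\infty$), and let $\lambda_b>0$. Let $L:\mathcal Y\times\mathbb R\to[0,\infty)$ be measurable, convex in its last argument, and Lipschitz continuous in its last argument with a constant not depending on $y$. Assume that the derivatives $L'(y,\cdot)$ and $L''(y,\cdot)$ with respect to the last argument exist and are continuous for every $y\in\mathcal Y$, with $0<\sup_{y\in\mathcal Y,\,t\in\mathbb R}|L'(y,t)|<\infty$ and $\sup_{y\in\mathcal Y,\,t\in\mathbb R}|L''(y,t)|<\infty$. Put $L^\star(y,t)=L(y,t)-L(y,0)$. For a probability measure $Q$ on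 $\mathcal X_b\times\mathcal Y$, let $S_b(Q)=f_{b,Q}$ be the local SVM, the minimizer over $f\in H_b$ of $\int L^\star(y,f(x))\,dQ(x,y)+\lambda_b\|f\|_{H_b}^2$. For a probability measure $P$ on $\mathcal X\times\mathcal Y$ let $P_b$ be the restriction of $P$ to $\mathcal X_b\times\mathcal Y$ divided by $P(\mathcal X_b\times\mathcal Y)$ (the null measure if $P(\mathcal X_b\times\mathcal Y)=0$). For a family $Q=(Q_b)_b$ of measures on the sets $\mathcal X_b\times\mathcal Y$ put $F_Q(x)=\sum_{b=1}^B w_b(x)f_{b,Q_b}(x)$, where $f_{b,Q_b}$ is an arbitrary measurable function if $Q_b$ is not a probability measure, and a summand is $0$ for $x\notin\mathcal X_b$. Put $f^{\mathrm{comp}}_P=F_{(P_b)_b}$. For $z\in\mathcal X\times\mathcal Y$ and $\varepsilon\in[0,1]$ put $\tilde P_{b,\varepsilon,z}=(1-\varepsilon)P_b+\varepsilon\delta_z$ if $z\in\mathcal X_b\times\mathcal Y$, and $\tilde P_{b,\varepsilon,z}=P_b$ otherwise. If $P(\mathcal X_b\times\mathcal Y)>0$ and $z\in\mathcal X_b\times\mathcal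 Y$, the local influence function is the limit in $H_b$ $$\mathrm{IF}_b(\delta_z;S_b,P_b)=\lim_{\varepsilon\downarrow0}\frac{S_b((1-\varepsilon)P_b+\varepsilon\delta_z)-S_b(P_b)}{\varepsilon};$$ in all other cases $\mathrm{IF}_b(\delta_z;S_b,P_b):=0$. Then for every probability measure $P$ on $\mathcal X\times\mathcal Y$ the following hold, where $P^{\mathcal X}$ is the marginal of $P$ on $\mathcal X$. (0) For every $b$ and every probability measure $Q$ on $\mathcal X_b\times\mathcal Y$ the local SVM $f_{b,Q}$ exists and is unique. There is a constant $C$, not depending on $z$, such that for every $z\in\mathcal X\times\mathcal Y$: (1) all local influence functions $\mathrm{IF}_b(\delta_z;S_b,P_b)$ exist; (2) (contamination within the regions) the functions $F_{(\tilde P_{b,\varepsilon,z})_b}$, $0\le\varepsilon<1$, belong to $L^\infty(P^{\mathcal X})$; the influence function of the composed predictor $$\mathrm{IF}^{\mathrm{comp}}(\delta_z;S,P)=\lim_{\varepsilon\downarrow0}\frac{F_{(\tilde P_{b,\varepsilon,z})_b}-f^{\mathrm{comp}}_P}{\varepsilon}$$ exists as a limit in $L^\infty(P^{\mathcal X})$,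 is bounded by $C$ in the norm of $L^\infty(P^{\mathcal X})$, and equals $\sum_{b=1}^B w_b\,\mathrm{IF}_b(\delta_z;S_b,P_b)$ $P^{\mathcal X}$-almost everywhere; (3) (contamination of $P$, followed by regional restriction and normalization) the functions $f^{\mathrm{comp}}_{(1-\varepsilon)P+\varepsilon\delta_z}$, $0\le\varepsilon<1$, belong to $L^\infty(P^{\mathcal X})$; the limit $$\lim_{\varepsilon\downarrow0}\frac{f^{\mathrm{comp}}_{(1-\varepsilon)P+\varepsilon\delta_z}-f^{\mathrm{comp}}_P}{\varepsilon}$$ exists in $L^\infty(P^{\mathcal X})$, is bounded by $C$ in norm, and equals $\sum_{b:\,P(\mathcal X_b\times\mathcal Y)>0}P(\mathcal X_b\times\mathcal Y)^{-1}\,w_b\,\mathrm{IF}_b(\delta_z;S_b,P_b)$ $P^{\mathcal X}$-almost everywhere. -/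

import Mathlib

open MeasureTheory Filter Topology Set
open scoped ENNReal

noncomputable section

namespace LocalSVM

/-- The real-valued reproducing kernel `k(x, x')` of a reproducing kernel Hilbert space of
real functions. Mathlib's `RKHS.kernel` is operator valued; an operator on `ℝ` is
identified with its value at `1`. -/
def scalarKernel {X : Type*} (H : Type*) [NormedAddCommGroup H] [InnerProductSpace ℝ H]
    [CompleteSpace H] [RKHS ℝ H X ℝ] (x x' : X) : ℝ :=
  RKHS.kernel H x x' 1

/-- The shifted loss `L⋆(y, t) = L(y, t) - L(y, 0)`. -/
def shiftedLoss {Y : Type*} (L : Y → ℝ → ℝ) (y : Y) (t : ℝ) : ℝ := L y t - L y 0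

section SVM

variable {X Y : Type*} [MeasurableSpace X] [MeasurableSpace Y]
  {H : Type*} [NormedAddCommGroup H] [InnerProductSpace ℝ H] [RKHS ℝ H X ℝ]

/-- The regularized theoretical risk `∫ L⋆(y, f(x)) dQ(x, y) + lam ‖f‖²` of `f ∈ H`. -/
def regRisk (L : Y → ℝ → ℝ) (Q : Measure (X × Y)) (lam : ℝ) (f : H) : ℝ :=
  ∫ p, shiftedLoss L p.2 (f p.1) ∂Q + lam * ‖f‖ ^ 2

/-- `f` is a (theoretical) support vector machine for `L⋆`, `Q`, `lam`: it minimizes the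
regularized risk over `H`. -/
def IsSVM (L : Y → ℝ → ℝ) (Q : Measure (X × Y)) (lam : ℝ) (f : H) : Prop :=
  ∀ h : H, regRisk L Q lam f ≤ regRisk L Q lam h

/-- The support vector machine, as a statistical operator `Q ↦ svm H L lam Q ∈ H`
(a minimizer of the regularized risk; arbitrary when there is none). -/
def svm (H : Type*) [NormedAddCommGroup H] [InnerProductSpace ℝ H] [RKHS ℝ H X ℝ]
    (L : Y → ℝ → ℝ) (lam : ℝ) (Q : Measure (X × Y)) : H :=
  Classical.epsilon fun f : H => IsSVM L Q lam f

end SVM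

section Influence

/-- The mixture `(1 - ε) P + ε δ_z`, for `0 ≤ ε ≤ 1`. -/
def contaminate {M : Type*} [MeasurableSpace M] (P : Measure M) (z : M) (ε : ℝ) : Measure M :=
  ENNReal.ofReal (1 - ε) • P + ENNReal.ofReal ε • Measure.dirac z

/-- `g` is the influence function of the statistical operator `S` at the point `z` for `P`:
the limit in `E`, as `ε ↓ 0`, of `(S((1 - ε) P + ε δ_z) - S(P)) / ε`. -/
def HasInfluenceFunction {M E : Type*} [MeasurableSpace M] [NormedAddCommGroup E]
    [NormedSpace ℝ E] (S : Measure M → E) (P : Measure M) (z : M) (g : E) : Prop :=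
  Tendsto (fun ε : ℝ => ε⁻¹ • (S (contaminate P z ε) - S P)) (𝓝[>] 0) (𝓝 g)

open Classical in
/-- The class in `L^∞(μ)` of a function; only meaningful for `f` with `MemLp f ∞ μ`. -/
def linftyClass {X : Type*} [MeasurableSpace X] (μ : Measure X) (f : X → ℝ) : Lp ℝ ∞ μ :=
  if h : MemLp f ∞ μ then h.toLp f else 0

end Influence

section Regions

variable {X Y : Type*} [MeasurableSpace X] [MeasurableSpace Y]

/-- The regional distribution on `A × Y`: the restriction of `P` to `A × Y`, divided by
`P(A × Y)`. It is the null measure when `P(A × Y) = 0`, since then it is `∞ • 0`. -/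
def regional (A : Set X) (P : Measure (X × Y)) : Measure (A × Y) :=
  (P (A ×ˢ univ))⁻¹ • P.comap (fun p : A × Y => ((p.1 : X), p.2))

open Classical in
/-- The regionwise mixture: `(1 - ε) P_A + ε δ_z` if `z ∈ A × Y`, and `P_A` otherwise, where
`P_A` is the regional distribution of `P` on `A × Y`. -/
def regionalContaminate (A : Set X) (P : Measure (X × Y)) (z : X × Y) (ε : ℝ) :
    Measure (A × Y) :=
  if h : z.1 ∈ A then contaminate (regional A P) (⟨z.1, h⟩, z.2) ε else regional A P

open Classical in
/-- Extension of a function on a region by zero. -/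
def extendZero {A : Set X} (f : A → ℝ) (x : X) : ℝ := if h : x ∈ A then f ⟨x, h⟩ else 0

open Classical in
/-- The predictor composed of local support vector machines,
`x ↦ ∑ b, w b x * f_b x`, where `f_b` is the support vector machine in `H b` for `Q b` if `Q b`
is a probability measure on `R b × Y`, and the prescribed function `v b` otherwise. -/
def compose {B : ℕ} {R : Fin B → Set X} (H : Fin B → Type*)
    [∀ b, NormedAddCommGroup (H b)] [∀ b, InnerProductSpace ℝ (H b)]
    [∀ b, RKHS ℝ (H b) (R b) ℝ] (L : Y → ℝ → ℝ) (lam : Fin B → ℝ) (w : Fin B → X → ℝ)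
    (v : ∀ b, R b → ℝ) (Q : ∀ b, Measure (R b × Y)) (x : X) : ℝ :=
  ∑ b, w b x *
    extendZero (if IsProbabilityMeasure (Q b) then ⇑(svm (H b) L (lam b) (Q b)) else v b) x

/-- The composed predictor `f^comp` of a distribution `P` on `X × Y`; `u P b` is the arbitrary
function used on regions with `P(R b × Y) = 0`. -/
def compPredictor {B : ℕ} {R : Fin B → Set X} (H : Fin B → Type*)
    [∀ b, NormedAddCommGroup (H b)] [∀ b, InnerProductSpace ℝ (H b)]
    [∀ b, RKHS ℝ (H b) (R b) ℝ] (L : Y → ℝ → ℝ) (lam : Fin B → ℝ) (w : Fin B → X → ℝ)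
    (u : Measure (X × Y) → ∀ b, R b → ℝ) (P : Measure (X × Y)) : X → ℝ :=
  compose H L lam w (u P) fun b => regional (R b) P

/-- The composed predictor whose local support vector machines are learned from the regionwise
mixtures `(1 - ε) P_b + ε δ_z` (if `z ∈ R b × Y`) and `P_b` (otherwise). -/
def regionalCompPredictor {B : ℕ} {R : Fin B → Set X} (H : Fin B → Type*)
    [∀ b, NormedAddCommGroup (H b)] [∀ b, InnerProductSpace ℝ (H b)]
    [∀ b, RKHS ℝ (H b) (R b) ℝ] (L : Y → ℝ → ℝ) (lam : Fin B → ℝ) (w : Fin B → X → ℝ)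
    (u : Measure (X × Y) → ∀ b, R b → ℝ) (P : Measure (X × Y)) (z : X × Y) (ε : ℝ) : X → ℝ :=
  compose H L lam w (u (contaminate P z ε)) fun b => regionalContaminate (R b) P z ε

/-- `g` is the local influence function `IF_b(δ_z; S_b, P_b)` of the local support vector machine
`S_b : Q ↦ svm H L lam Q` on the region `A`: if `P(A × Y) > 0` and `z ∈ A × Y` it is the influence
function of `S_b` at `z` for `P_b`; regions that `δ_z` does not affect, and `P`-null
regions, have local influence function `0`. -/
def IsLocalInfluenceFunction {A : Set X} {H : Type*} [NormedAddCommGroup H]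
    [InnerProductSpace ℝ H] [RKHS ℝ H A ℝ] (L : Y → ℝ → ℝ) (lam : ℝ) (P : Measure (X × Y))
    (z : X × Y) (g : H) : Prop :=
  (∀ h : z.1 ∈ A, P (A ×ˢ univ) ≠ 0 →
    HasInfluenceFunction (svm H L lam) (regional A P) (⟨z.1, h⟩, z.2) g) ∧
  (z.1 ∉ A ∨ P (A ×ˢ univ) = 0 → g = 0)

end Regions

end LocalSVM

end

/-! A local SVM is the unique zero in `H` of the gradient `G f = 2λ f + ∫ L'(y, f x) Φ(x) dQ`, with
`Φ` the feature map. Convexity of `L` makes `G` strongly monotone with constant `2λ`; boundedness of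
`L''` and of the kernel makes it Lipschitz and differentiable (`exists_hasFDerivAt_riskGradient`).

The gradient is affine in `Q`, so contamination replaces `G` by `G + ε D`, where `D` is continuous
at the SVM and `‖D‖ ≤ 2 M₁ κ` whatever the point `z`. `exists_tendsto_perturbed_zero` expands the
zero to first order: the influence function `g` solves `T g = -D f₀`, with `T` the derivative of `G`
at the SVM `f₀`, and coercivity of `T` gives the bound `2 M₁ κ / (2λ)`, uniform in `z`.

Multiplication by `w b` is a continuous linear map from `H b` to `L^∞` (`weightedEmbedding`), so
local limits pass to the finite sum. It kills everything on null regions, where the predictor is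
arbitrary. Contaminating `P` itself contaminates a region of mass `p` containing `z` with weight `ε
/ ((1 - ε) p + ε) ~ ε / p`, whence the factor `1 / p`. -/

namespace LocalSVM

open scoped RealInnerProductSpace

/-! ### Zeros of strongly monotone maps and their perturbation. -/

section StronglyMonotone

variable {E : Type*} [NormedAddCommGroup E] [InnerProductSpace ℝ E]

/-- A Lipschitz continuous, strongly monotone map on a Hilbert space has a zero. -/
theorem exists_zero_of_stronglyMonotone [CompleteSpace E] {G : E → E} {m K : ℝ} (hm : 0 < m)
    (hK : ∀ f g, ‖G f - G g‖ ≤ K * ‖f - g‖)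
    (hmono : ∀ f g, m * ‖f - g‖ ^ 2 ≤ ⟪G f - G g, f - g⟫) : ∃ f, G f = 0 := by
  -- A Lipschitz constant above `m` is positive and gives `τ m ≤ 1`.
  obtain ⟨K', hK'm, hK'⟩ : ∃ K', m < K' ∧ ∀ f g, ‖G f - G g‖ ≤ K' * ‖f - g‖ :=
    ⟨max K (m + 1), by simp, fun f g => (hK f g).trans (by gcongr; exact le_max_left _ _)⟩
  have hK'0 : 0 < K' := hm.trans hK'm
  -- This step size minimizes `1 - 2τm + τ²K'²`, which bounds the squared contraction factor of `f ↦
  -- f - τ G f`; the minimum is `q = 1 - τm`.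
  set τ : ℝ := m / K' ^ 2 with hτ
  have hτ0 : 0 < τ := by positivity
  set q : ℝ := 1 - τ * m with hq
  have hτK : τ ^ 2 * K' ^ 2 = τ * m := by rw [hτ]; field_simp
  have hq0 : 0 ≤ q := by
    have : τ * m ≤ 1 := by
      rw [hτ, div_mul_eq_mul_div, div_le_one (by positivity)]
      nlinarith
    linarith
  have hq1 : q < 1 := by have : 0 < τ * m := by positivity
                         linarith
  have hcontr : ContractingWith (√q).toNNReal (fun f => f - τ • G f) := by
    refine ⟨?_, LipschitzWith.of_dist_le_mul fun f g => ?_⟩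
    · simpa [Real.toNNReal_lt_one, Real.sqrt_lt' one_pos] using hq1
    · rw [dist_eq_norm, dist_eq_norm]
      rw [Real.coe_toNNReal _ (Real.sqrt_nonneg q)]
      refine abs_le_of_sq_le_sq' ?_ (by positivity) |>.2
      have h1 : f - τ • G f - (g - τ • G g) = (f - g) - τ • (G f - G g) := by
        rw [smul_sub]; abel
      have h2 : ‖G f - G g‖ ^ 2 ≤ K' ^ 2 * ‖f - g‖ ^ 2 := by
        rw [← mul_pow]; gcongr; exact hK' f g
      rw [h1, norm_sub_sq_real, mul_pow, Real.sq_sqrt hq0, norm_smul, inner_smul_right,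
        real_inner_comm, mul_pow, Real.norm_eq_abs, sq_abs]
      have h3 := mul_le_mul_of_nonneg_left h2 (sq_nonneg τ)
      have h4 := mul_le_mul_of_nonneg_left (hmono f g) hτ0.le
      rw [← mul_assoc, hτK] at h3
      rw [hq]
      linarith
  have : Nonempty E := ⟨0⟩
  refine ⟨hcontr.fixedPoint _, ?_⟩
  have := hcontr.fixedPoint_isFixedPt
  simpa [Function.IsFixedPt, hτ0.ne'] using this

/-- The derivative of a strongly monotone map is coercive. -/
theorem coercive_of_hasFDerivAt {G : E → E} {m : ℝ}
    (hmono : ∀ f g, m * ‖f - g‖ ^ 2 ≤ ⟪G f - G g, f - g⟫) {f₀ : E} {T : E →L[ℝ] E}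
    (hT : HasFDerivAt G T f₀) (h : E) : m * ‖h‖ ^ 2 ≤ ⟪T h, h⟫ := by
  have hlim := ((hT.hasLineDerivAt h).tendsto_slope_zero_right).inner (𝕜 := ℝ)
    (tendsto_const_nhds (x := h))
  refine ge_of_tendsto hlim ?_
  filter_upwards [self_mem_nhdsWithin] with t ht
  have ht : 0 < t := ht
  have := hmono (f₀ + t • h) f₀
  rw [add_sub_cancel_left, norm_smul, inner_smul_right, Real.norm_eq_abs, mul_pow, sq_abs] at this
  rw [inner_smul_left, RCLike.conj_to_real, inv_mul_eq_div, le_div_iff₀ ht]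
  nlinarith

theorem norm_le_of_coercive {T : E → E} {m : ℝ}
    (hT : ∀ h, m * ‖h‖ ^ 2 ≤ ⟪T h, h⟫) (h : E) : m * ‖h‖ ≤ ‖T h‖ := by
  rcases eq_or_ne h 0 with rfl | hh
  · simp
  · have h1 := (hT h).trans (real_inner_le_norm _ _)
    have h2 : 0 < ‖h‖ := norm_pos_iff.2 hh
    nlinarith

/-- First order expansion of the zeros of the perturbations `G + ε D` of a strongly monotone
map `G`. -/
theorem exists_tendsto_perturbed_zero [CompleteSpace E] {G D : E → E} {m M : ℝ} (hm : 0 < m)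
    (hmono : ∀ f g, m * ‖f - g‖ ^ 2 ≤ ⟪G f - G g, f - g⟫) {f₀ : E} (h₀ : G f₀ = 0)
    {T : E →L[ℝ] E} (hT : HasFDerivAt G T f₀) (hD : ContinuousAt D f₀) (hM : ∀ f, ‖D f‖ ≤ M)
    {f : ℝ → E} (hf : ∀ᶠ ε in 𝓝[>] (0 : ℝ), G (f ε) + ε • D (f ε) = 0) :
    ∃ g, Tendsto (fun ε : ℝ => ε⁻¹ • (f ε - f₀)) (𝓝[>] 0) (𝓝 g) ∧ ‖g‖ ≤ M / m := by
  have hcoer := coercive_of_hasFDerivAt hmono hT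
  -- A Lax–Milgram step: the coercive `T` plus a constant is again Lipschitz and strongly monotone.
  obtain ⟨g, hg⟩ : ∃ g, T g + D f₀ = 0 := by
    refine exists_zero_of_stronglyMonotone (G := fun h => T h + D f₀) (K := ‖T‖) hm ?_ ?_
    · intro a b
      simpa [← map_sub] using T.le_opNorm (a - b)
    · intro a b
      simpa [← map_sub] using hcoer (a - b)
  have hTg : T g = -D f₀ := eq_neg_of_add_eq_zero_left hg
  have hpos : ∀ᶠ ε in 𝓝[>] (0 : ℝ), 0 < ε := self_mem_nhdsWithin
  -- Strong monotonicity between `f ε` and `f₀`, with `G f₀ = 0` and `G (f ε) = -ε D (f ε)`.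
  have hbd : ∀ᶠ ε in 𝓝[>] (0 : ℝ), ‖f ε - f₀‖ ≤ M / m * ε := by
    filter_upwards [hf, hpos] with ε hε hε0
    have h1 := (hmono (f ε) f₀).trans (real_inner_le_norm _ _)
    rw [h₀, sub_zero, eq_neg_of_add_eq_zero_left hε, norm_neg, norm_smul, Real.norm_eq_abs,
      abs_of_pos hε0] at h1
    rw [div_mul_eq_mul_div, le_div_iff₀ hm]
    rcases (norm_nonneg (f ε - f₀)).eq_or_lt with h2 | h2
    · rw [← h2, zero_mul]
      exact mul_nonneg ((norm_nonneg _).trans (hM f₀)) hε0.le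
    · have h3 : ε * ‖D (f ε)‖ ≤ ε * M := by gcongr; exact hM _
      have h4 := mul_le_mul_of_nonneg_right h3 h2.le
      nlinarith
  have hlim : Tendsto f (𝓝[>] 0) (𝓝 f₀) := by
    rw [tendsto_iff_norm_sub_tendsto_zero]
    refine squeeze_zero' (Eventually.of_forall fun _ => norm_nonneg _) hbd ?_
    have : Tendsto (fun ε : ℝ => M / m * ε) (𝓝 0) (𝓝 (M / m * 0)) :=
      tendsto_id.const_mul _
    rw [mul_zero] at this
    exact this.mono_left nhdsWithin_le_nhds
  have hbigO : (fun ε => f ε - f₀) =O[𝓝[>] (0 : ℝ)] fun ε : ℝ => ε := by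
    refine Asymptotics.IsBigO.of_bound (M / m) ?_
    filter_upwards [hbd, hpos] with ε h1 h2
    rwa [Real.norm_eq_abs, abs_of_pos h2]
  have hlittle := ((hT.isLittleO.comp_tendsto hlim).trans_isBigO hbigO).tendsto_inv_smul_nhds_zero
  have hDlim : Tendsto (fun ε => D (f ε) - D f₀) (𝓝[>] 0) (𝓝 0) := by
    have := (hD.tendsto.comp hlim).sub_const (D f₀)
    simpa using this
  -- By the two equations for `f ε` and `g`, this is minus the sum of the rescaled Taylor remainder
  -- and `D (f ε) - D f₀`. Coercivity of `T` then removes `T`.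
  have hkey : Tendsto (fun ε : ℝ => T (ε⁻¹ • (f ε - f₀) - g)) (𝓝[>] 0) (𝓝 0) := by
    have h1 := (hlittle.add hDlim).neg
    rw [add_zero, neg_zero] at h1
    refine h1.congr' ?_
    filter_upwards [hf, hpos] with ε hε hε0
    simp only [Function.comp_apply, map_sub, map_smul]
    rw [h₀, hTg, eq_neg_of_add_eq_zero_left hε, sub_zero]
    simp only [smul_sub, smul_neg, smul_smul, inv_mul_cancel₀ hε0.ne', one_smul]
    abel
  refine ⟨g, ?_, ?_⟩
  · rw [tendsto_iff_norm_sub_tendsto_zero]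
    have h1 := hkey.norm.const_mul m⁻¹
    rw [norm_zero, mul_zero] at h1
    refine squeeze_zero (fun _ => norm_nonneg _) (fun ε => ?_) h1
    rw [inv_mul_eq_div, le_div_iff₀ hm, mul_comm]
    exact norm_le_of_coercive hcoer _
  · rw [le_div_iff₀ hm, mul_comm]
    refine (norm_le_of_coercive hcoer g).trans ?_
    rw [hTg, norm_neg]
    exact hM _

end StronglyMonotone

/-! ### Smooth convex losses. -/

section Loss

theorem add_mul_sub_le_of_convexOn {φ : ℝ → ℝ} (hφ : ConvexOn ℝ univ φ) {t a : ℝ}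
    (ha : HasDerivAt φ a t) (s : ℝ) : φ t + a * (s - t) ≤ φ s := by
  rcases lt_trichotomy t s with h | rfl | h
  · have := hφ.le_slope_of_hasDerivAt (mem_univ _) (mem_univ _) h ha
    rw [slope_def_field, le_div_iff₀ (sub_pos.2 h)] at this
    linarith
  · simp
  · have := hφ.slope_le_of_hasDerivAt (mem_univ _) (mem_univ _) h ha
    rw [slope_def_field, div_le_iff₀ (sub_pos.2 h)] at this
    linarith

variable {Y : Type*} [MeasurableSpace Y]

/-- The derivative is a pointwise limit of difference quotients with step `1 / (n + 1)`, each
jointly measurable. -/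
theorem measurable_uncurry_deriv {L : Y → ℝ → ℝ} (hL : Measurable (Function.uncurry L))
    (hd : ∀ y, Differentiable ℝ (L y)) : Measurable (Function.uncurry fun y => deriv (L y)) := by
  have hu : Tendsto (fun n : ℕ => 1 / ((n : ℝ) + 1)) atTop (𝓝[>] 0) :=
    tendsto_nhdsWithin_iff.2 ⟨tendsto_one_div_add_atTop_nhds_zero_nat,
      Eventually.of_forall fun n => by simp only [mem_Ioi]; positivity⟩
  refine measurable_of_tendsto_metrizable (f := fun (n : ℕ) (p : Y × ℝ) =>
    (1 / ((n : ℝ) + 1))⁻¹ • (L p.1 (p.2 + 1 / ((n : ℝ) + 1)) - L p.1 p.2)) (fun n => ?_) ?_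
  · have h1 : Measurable fun p : Y × ℝ => L p.1 (p.2 + 1 / ((n : ℝ) + 1)) :=
      hL.comp (measurable_fst.prodMk (measurable_snd.add_const _))
    exact (h1.sub hL).const_smul (1 / ((n : ℝ) + 1))⁻¹
  · rw [tendsto_pi_nhds]
    rintro ⟨y, t⟩
    exact ((hd y t).hasDerivAt.tendsto_slope_zero_right).comp hu

/-- A measurable convex loss with two continuous derivatives, bounded by `M₁` and `M₂`. -/
structure SmoothConvexLoss (L : Y → ℝ → ℝ) (M₁ M₂ : ℝ) : Prop where
  measurable : Measurable (Function.uncurry L)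
  contDiff : ∀ y, ContDiff ℝ 2 (L y)
  convex : ∀ y, ConvexOn ℝ univ (L y)
  abs_deriv_le : ∀ y t, |deriv (L y) t| ≤ M₁
  abs_deriv2_le : ∀ y t, |deriv (deriv (L y)) t| ≤ M₂

namespace SmoothConvexLoss

variable {L : Y → ℝ → ℝ} {M₁ M₂ : ℝ}

theorem hasDerivAt (hL : SmoothConvexLoss L M₁ M₂) (y : Y) (t : ℝ) :
    HasDerivAt (L y) (deriv (L y) t) t :=
  ((hL.contDiff y).differentiable (by norm_num) t).hasDerivAt

theorem contDiff_deriv (hL : SmoothConvexLoss L M₁ M₂) (y : Y) : ContDiff ℝ 1 (deriv (L y)) := by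
  have := hL.contDiff y
  rw [show (2 : WithTop ℕ∞) = 1 + 1 by norm_num, contDiff_succ_iff_deriv] at this
  exact this.2.2

theorem hasDerivAt_deriv (hL : SmoothConvexLoss L M₁ M₂) (y : Y) (t : ℝ) :
    HasDerivAt (deriv (L y)) (deriv (deriv (L y)) t) t :=
  ((hL.contDiff_deriv y).differentiable (by norm_num) t).hasDerivAt

theorem measurable_deriv (hL : SmoothConvexLoss L M₁ M₂) :
    Measurable (Function.uncurry fun y => deriv (L y)) :=
  measurable_uncurry_deriv hL.measurable fun y => (hL.contDiff y).differentiable (by norm_num)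

theorem measurable_deriv2 (hL : SmoothConvexLoss L M₁ M₂) :
    Measurable (Function.uncurry fun y => deriv (deriv (L y))) :=
  measurable_uncurry_deriv hL.measurable_deriv
    fun y => (hL.contDiff_deriv y).differentiable (by norm_num)

theorem abs_sub_le (hL : SmoothConvexLoss L M₁ M₂) (y : Y) (s t : ℝ) :
    |L y s - L y t| ≤ M₁ * |s - t| :=
  convex_univ.norm_image_sub_le_of_norm_deriv_le
    (fun x _ => (hL.hasDerivAt y x).differentiableAt) (fun x _ => hL.abs_deriv_le y x)
    (mem_univ t) (mem_univ s)

theorem abs_deriv_sub_le (hL : SmoothConvexLoss L M₁ M₂) (y : Y) (s t : ℝ) :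
    |deriv (L y) s - deriv (L y) t| ≤ M₂ * |s - t| :=
  convex_univ.norm_image_sub_le_of_norm_deriv_le
    (fun x _ => (hL.hasDerivAt_deriv y x).differentiableAt) (fun x _ => hL.abs_deriv2_le y x)
    (mem_univ t) (mem_univ s)

/-- Sum of the tangent inequalities at `s` and at `t`. -/
theorem deriv_sub_mul_sub_nonneg (hL : SmoothConvexLoss L M₁ M₂) (y : Y) (s t : ℝ) :
    0 ≤ (deriv (L y) s - deriv (L y) t) * (s - t) := by
  have h1 := add_mul_sub_le_of_convexOn (hL.convex y) (hL.hasDerivAt y s) t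
  have h2 := add_mul_sub_le_of_convexOn (hL.convex y) (hL.hasDerivAt y t) s
  linarith

end SmoothConvexLoss

end Loss

/-! ### The risk gradient, the SVM as its zero, and the local influence function. -/

section Gradient

variable {A Y : Type*} [MeasurableSpace A] [MeasurableSpace Y]
  {H : Type*} [NormedAddCommGroup H] [InnerProductSpace ℝ H] [CompleteSpace H] [RKHS ℝ H A ℝ]

omit [MeasurableSpace A] in
theorem inner_kerFun_one (x : A) (f : H) : ⟪RKHS.kerFun H x 1, f⟫ = f x := by
  simp

/-- The feature map `x ↦ k(·, x)` is strongly measurable and bounded by `κ`. -/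
structure BoundedFeature (H : Type*) [NormedAddCommGroup H] [InnerProductSpace ℝ H]
    [CompleteSpace H] [RKHS ℝ H A ℝ] (κ : ℝ) : Prop where
  stronglyMeasurable : StronglyMeasurable fun x : A => RKHS.kerFun H x 1
  nonneg : 0 ≤ κ
  norm_le : ∀ x : A, ‖RKHS.kerFun H x 1‖ ≤ κ

/-- The gradient of the regularized risk. -/
noncomputable def riskGradient (L : Y → ℝ → ℝ) (Q : Measure (A × Y)) (lam : ℝ) (f : H) : H :=
  (2 * lam) • f + ∫ p, deriv (L p.2) (f p.1) • RKHS.kerFun H p.1 1 ∂Q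

variable {L : Y → ℝ → ℝ} {M₁ M₂ κ lam : ℝ} {Q : Measure (A × Y)}

theorem BoundedFeature.measurable_coe (hΦ : BoundedFeature (A := A) H κ) (f : H) :
    Measurable (f : A → ℝ) := by
  have := (hΦ.stronglyMeasurable.inner (𝕜 := ℝ) (stronglyMeasurable_const (b := f))).measurable
  simpa only [inner_kerFun_one] using this

theorem BoundedFeature.abs_apply_le (hΦ : BoundedFeature (A := A) H κ) (f : H) (x : A) :
    |f x| ≤ κ * ‖f‖ := by
  rw [← inner_kerFun_one]
  exact (abs_real_inner_le_norm _ _).trans (by gcongr; exact hΦ.norm_le x)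

theorem stronglyMeasurable_deriv_smul (hL : SmoothConvexLoss L M₁ M₂)
    (hΦ : BoundedFeature (A := A) H κ) (f : H) :
    StronglyMeasurable fun p : A × Y => deriv (L p.2) (f p.1) • RKHS.kerFun H p.1 1 := by
  refine StronglyMeasurable.smul ?_ (hΦ.stronglyMeasurable.comp_measurable measurable_fst)
  exact (hL.measurable_deriv.comp
    (measurable_snd.prodMk ((hΦ.measurable_coe f).comp measurable_fst))).stronglyMeasurable

theorem norm_deriv_smul_le (hL : SmoothConvexLoss L M₁ M₂)
    (hΦ : BoundedFeature (A := A) H κ) (f : H) (p : A × Y) :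
    ‖deriv (L p.2) (f p.1) • RKHS.kerFun H p.1 1‖ ≤ M₁ * κ := by
  rw [norm_smul, Real.norm_eq_abs]
  have := (abs_nonneg _).trans (hL.abs_deriv_le p.2 (f p.1))
  gcongr
  exacts [hL.abs_deriv_le _ _, hΦ.norm_le _]

theorem integrable_deriv_smul [IsFiniteMeasure Q] (hL : SmoothConvexLoss L M₁ M₂)
    (hΦ : BoundedFeature (A := A) H κ) (f : H) :
    Integrable (fun p : A × Y => deriv (L p.2) (f p.1) • RKHS.kerFun H p.1 1) Q :=
  Integrable.of_bound (stronglyMeasurable_deriv_smul hL hΦ f).aestronglyMeasurable (M₁ * κ)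
    (Eventually.of_forall (norm_deriv_smul_le hL hΦ f))

theorem riskGradient_sub [IsFiniteMeasure Q] (hL : SmoothConvexLoss L M₁ M₂)
    (hΦ : BoundedFeature (A := A) H κ) (f g : H) :
    riskGradient L Q lam f - riskGradient L Q lam g = (2 * lam) • (f - g) +
      ∫ p, (deriv (L p.2) (f p.1) - deriv (L p.2) (g p.1)) • RKHS.kerFun H p.1 1 ∂Q := by
  simp only [riskGradient, sub_smul]
  rw [integral_sub (integrable_deriv_smul hL hΦ f) (integrable_deriv_smul hL hΦ g), smul_sub]
  abel

/-- One factor `κ` comes from evaluating `f - g` at a point, the other from the norm of the feature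
vector. -/
theorem norm_riskGradient_sub_le [IsFiniteMeasure Q] (hL : SmoothConvexLoss L M₁ M₂)
    (hΦ : BoundedFeature (A := A) H κ) (f g : H) :
    ‖riskGradient L Q lam f - riskGradient L Q lam g‖ ≤
      (|2 * lam| + M₂ * κ * κ * Q.real univ) * ‖f - g‖ := by
  rw [riskGradient_sub hL hΦ, add_mul]
  refine (norm_add_le _ _).trans (add_le_add (by rw [norm_smul, Real.norm_eq_abs]) ?_)
  have : ∀ p : A × Y, ‖(deriv (L p.2) (f p.1) - deriv (L p.2) (g p.1)) • RKHS.kerFun H p.1 1‖ ≤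
      M₂ * κ * κ * ‖f - g‖ := fun p => by
    have h0 := (abs_nonneg _).trans (hL.abs_deriv2_le p.2 0)
    have h1 := (hL.abs_deriv_sub_le p.2 (f p.1) (g p.1)).trans
      (mul_le_mul_of_nonneg_left (by simpa using hΦ.abs_apply_le (f - g) p.1) h0)
    rw [norm_smul, Real.norm_eq_abs]
    calc _ ≤ (M₂ * (κ * ‖f - g‖)) * κ :=
          mul_le_mul h1 (hΦ.norm_le _) (norm_nonneg _) ((abs_nonneg _).trans h1)
      _ = _ := by ring
  refine (norm_integral_le_of_norm_le_const (Eventually.of_forall this)).trans_eq (by ring)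

/-- The constant comes from the regularizer alone; the loss term contributes a nonnegative integral
because `L'` is monotone. -/
theorem le_inner_riskGradient_sub [IsFiniteMeasure Q] (hL : SmoothConvexLoss L M₁ M₂)
    (hΦ : BoundedFeature (A := A) H κ) (f g : H) :
    2 * lam * ‖f - g‖ ^ 2 ≤ ⟪riskGradient L Q lam f - riskGradient L Q lam g, f - g⟫ := by
  rw [riskGradient_sub hL hΦ, inner_add_left, inner_smul_left, real_inner_self_eq_norm_sq,
    RCLike.conj_to_real, real_inner_comm, ← integral_inner]
  · refine le_add_of_nonneg_right (integral_nonneg fun p => ?_)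
    simp only [Pi.zero_apply]
    rw [inner_smul_right, real_inner_comm, inner_kerFun_one]
    simpa using hL.deriv_sub_mul_sub_nonneg p.2 (f p.1) (g p.1)
  · simp only [sub_smul]
    exact (integrable_deriv_smul hL hΦ f).sub (integrable_deriv_smul hL hΦ g)

theorem exists_riskGradient_eq_zero [IsFiniteMeasure Q] (hL : SmoothConvexLoss L M₁ M₂)
    (hΦ : BoundedFeature (A := A) H κ) (hlam : 0 < lam) :
    ∃ f : H, riskGradient L Q lam f = 0 :=
  exists_zero_of_stronglyMonotone (mul_pos two_pos hlam) (norm_riskGradient_sub_le hL hΦ)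
    (le_inner_riskGradient_sub hL hΦ)

theorem integrable_shiftedLoss [IsFiniteMeasure Q] (hL : SmoothConvexLoss L M₁ M₂)
    (hΦ : BoundedFeature (A := A) H κ) (f : H) :
    Integrable (fun p : A × Y => shiftedLoss L p.2 (f p.1)) Q := by
  have hm : Measurable fun p : A × Y => shiftedLoss L p.2 (f p.1) :=
    (hL.measurable.comp (measurable_snd.prodMk ((hΦ.measurable_coe f).comp measurable_fst))).sub
      (hL.measurable.comp (measurable_snd.prodMk measurable_const))
  refine Integrable.of_bound hm.aestronglyMeasurable (M₁ * (κ * ‖f‖))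
    (Eventually.of_forall fun p => ?_)
  have h0 := (abs_nonneg _).trans (hL.abs_deriv_le p.2 0)
  refine (hL.abs_sub_le p.2 _ _).trans ?_
  rw [sub_zero]
  gcongr
  exact hΦ.abs_apply_le f p.1

/-- First order convexity of the regularized risk. -/
theorem regRisk_add_inner_le [IsFiniteMeasure Q] (hL : SmoothConvexLoss L M₁ M₂)
    (hΦ : BoundedFeature (A := A) H κ) (f h : H) :
    regRisk L Q lam f + ⟪riskGradient L Q lam f, h - f⟫ + lam * ‖h - f‖ ^ 2 ≤
      regRisk L Q lam h := by
  have h1 : ∫ p, shiftedLoss L p.2 (f p.1) ∂Q +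
      ∫ p, ⟪h - f, deriv (L p.2) (f p.1) • RKHS.kerFun H p.1 1⟫ ∂Q ≤
      ∫ p, shiftedLoss L p.2 (h p.1) ∂Q := by
    have hi := (integrable_deriv_smul (Q := Q) hL hΦ f).const_inner (𝕜 := ℝ) (h - f)
    rw [← integral_add (integrable_shiftedLoss hL hΦ f) hi]
    refine integral_mono ((integrable_shiftedLoss hL hΦ f).add hi)
      (integrable_shiftedLoss hL hΦ h) fun p => ?_
    have := add_mul_sub_le_of_convexOn (hL.convex p.2) (hL.hasDerivAt p.2 (f p.1)) (h p.1)
    have h2 : ⟪h - f, deriv (L p.2) (f p.1) • RKHS.kerFun H p.1 1⟫ =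
        deriv (L p.2) (f p.1) * (h p.1 - f p.1) := by
      rw [inner_smul_right, real_inner_comm, inner_kerFun_one]; simp
    simp only [shiftedLoss, h2]
    linarith
  rw [integral_inner (integrable_deriv_smul hL hΦ f)] at h1
  have h3 : ‖h‖ ^ 2 = ‖f‖ ^ 2 + 2 * ⟪f, h - f⟫ + ‖h - f‖ ^ 2 := by
    rw [← norm_add_sq_real, add_sub_cancel]
  rw [regRisk, regRisk, riskGradient, inner_add_left, inner_smul_left, RCLike.conj_to_real, h3,
    real_inner_comm (h - f) (∫ p, _ ∂Q)]
  linarith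

/-- The risk need not be differentiated: a zero `g` of the gradient exists, the risk grows
quadratically away from it, so any minimizer equals `g`. -/
theorem isSVM_iff_riskGradient_eq_zero [IsFiniteMeasure Q] (hL : SmoothConvexLoss L M₁ M₂)
    (hΦ : BoundedFeature (A := A) H κ) (hlam : 0 < lam) (f : H) :
    IsSVM L Q lam f ↔ riskGradient L Q lam f = 0 := by
  have key : ∀ g : H, riskGradient L Q lam g = 0 → ∀ h : H,
      regRisk L Q lam g + lam * ‖h - g‖ ^ 2 ≤ regRisk L Q lam h := fun g hg h => by
    simpa [hg] using regRisk_add_inner_le (lam := lam) (Q := Q) hL hΦ g h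
  refine ⟨fun hf => ?_, fun hf h => ?_⟩
  · obtain ⟨g, hg⟩ := exists_riskGradient_eq_zero (H := H) (Q := Q) hL hΦ hlam
    have h1 := key g hg f
    have h2 := hf g
    have h3 : ‖f - g‖ ^ 2 ≤ 0 := by nlinarith
    have h4 : f = g := by simpa [sub_eq_zero] using le_antisymm h3 (sq_nonneg _)
    rw [h4, hg]
  · have : 0 ≤ lam * ‖h - f‖ ^ 2 := by positivity
    linarith [key f hf h]

theorem existsUnique_isSVM [IsFiniteMeasure Q] (hL : SmoothConvexLoss L M₁ M₂)
    (hΦ : BoundedFeature (A := A) H κ) (hlam : 0 < lam) : ∃! f : H, IsSVM L Q lam f := by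
  simp only [isSVM_iff_riskGradient_eq_zero hL hΦ hlam]
  obtain ⟨f, hf⟩ := exists_riskGradient_eq_zero (H := H) (Q := Q) hL hΦ hlam
  refine ⟨f, hf, fun g hg => ?_⟩
  have hg : riskGradient L Q lam g = 0 := hg
  have h1 := le_inner_riskGradient_sub (lam := lam) (Q := Q) hL hΦ g f
  rw [hf, hg, sub_zero, inner_zero_left] at h1
  have h2 : ‖g - f‖ ^ 2 ≤ 0 := by nlinarith
  simpa [sub_eq_zero] using le_antisymm h2 (sq_nonneg _)

theorem riskGradient_svm [IsFiniteMeasure Q] (hL : SmoothConvexLoss L M₁ M₂)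
    (hΦ : BoundedFeature (A := A) H κ) (hlam : 0 < lam) :
    riskGradient L Q lam (svm H L lam Q) = 0 :=
  (isSVM_iff_riskGradient_eq_zero hL hΦ hlam _).1
    (Classical.epsilon_spec (existsUnique_isSVM hL hΦ hlam).exists)

-- Evaluation at a point is the inner product with the feature vector, so the chain rule gives a
-- rank-one operator.
omit [MeasurableSpace A] in
theorem hasFDerivAt_deriv_smul (hL : SmoothConvexLoss L M₁ M₂) (p : A × Y) (f : H) :
    HasFDerivAt (fun f : H => deriv (L p.2) (f p.1) • RKHS.kerFun H p.1 1)
      (deriv (deriv (L p.2)) (f p.1) •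
        (innerSL ℝ (RKHS.kerFun H p.1 1)).smulRight (RKHS.kerFun H p.1 1)) f := by
  have h1 : HasFDerivAt (fun f : H => f p.1) (innerSL ℝ (RKHS.kerFun H p.1 1)) f := by
    have := (innerSL ℝ (RKHS.kerFun H p.1 1)).hasFDerivAt (x := f)
    refine this.congr_of_eventuallyEq (Eventually.of_forall fun g => ?_)
    exact (inner_kerFun_one p.1 g).symm
  have h2 := ((hL.hasDerivAt_deriv p.2 (f p.1)).comp_hasFDerivAt f h1).smul_const
    (RKHS.kerFun H p.1 1)
  exact h2.congr_fderiv (ContinuousLinearMap.ext fun g => by simp [smul_smul])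

theorem exists_hasFDerivAt_riskGradient [IsFiniteMeasure Q] (hL : SmoothConvexLoss L M₁ M₂)
    (hΦ : BoundedFeature (A := A) H κ) (f : H) :
    ∃ T : H →L[ℝ] H, HasFDerivAt (riskGradient L Q lam) T f := by
  have h1 : StronglyMeasurable fun p : A × Y => RKHS.kerFun H p.1 1 :=
    hΦ.stronglyMeasurable.comp_measurable measurable_fst
  have h2 : StronglyMeasurable fun p : A × Y => deriv (deriv (L p.2)) (f p.1) •
        (innerSL ℝ (RKHS.kerFun H p.1 1)).smulRight (RKHS.kerFun H p.1 1) := by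
    have hs : StronglyMeasurable fun p : A × Y => deriv (deriv (L p.2)) (f p.1) :=
      (hL.measurable_deriv2.comp
        (measurable_snd.prodMk ((hΦ.measurable_coe f).comp measurable_fst))).stronglyMeasurable
    have hc : Continuous fun v : H => (innerSL ℝ v).smulRight v := by fun_prop
    exact hs.smul (hc.comp_stronglyMeasurable h1)
  have hint := hasFDerivAt_integral_of_dominated_of_fderiv_le (𝕜 := ℝ) (μ := Q)
    (F := fun (f : H) (p : A × Y) => deriv (L p.2) (f p.1) • RKHS.kerFun H p.1 1)
    (bound := fun _ => M₂ * (κ * κ)) (x₀ := f) univ_mem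
    (Eventually.of_forall fun g => (stronglyMeasurable_deriv_smul hL hΦ g).aestronglyMeasurable)
    (integrable_deriv_smul hL hΦ f) h2.aestronglyMeasurable ?_ (integrable_const _)
    (Eventually.of_forall fun p g _ => hasFDerivAt_deriv_smul hL p g)
  · exact ⟨_, ((hasFDerivAt_id f).const_smul (2 * lam)).add hint⟩
  · refine Eventually.of_forall fun p g _ => ?_
    have h0 := (norm_nonneg _).trans (hΦ.norm_le p.1)
    have h3 := (abs_nonneg _).trans (hL.abs_deriv2_le p.2 (g p.1))
    rw [norm_smul, ContinuousLinearMap.norm_smulRight_apply, innerSL_apply_norm, Real.norm_eq_abs]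
    gcongr
    exacts [hL.abs_deriv2_le _ _, hΦ.norm_le _, hΦ.norm_le _]

theorem isProbabilityMeasure_contaminate {M : Type*} [MeasurableSpace M] (P : Measure M)
    [IsProbabilityMeasure P] (z : M) {ε : ℝ} (hε : ε ∈ Icc (0 : ℝ) 1) :
    IsProbabilityMeasure (contaminate P z ε) := by
  refine ⟨?_⟩
  simp only [contaminate, Measure.add_apply, Measure.smul_apply, measure_univ, smul_eq_mul,
    mul_one]
  rw [← ENNReal.ofReal_add (sub_nonneg.2 hε.2) hε.1]
  simp

/-- The gradient is affine in the measure; this puts contamination in the form `G + ε D`. -/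
theorem riskGradient_contaminate [IsProbabilityMeasure Q] (hL : SmoothConvexLoss L M₁ M₂)
    (hΦ : BoundedFeature (A := A) H κ) (z : A × Y) {ε : ℝ} (hε : ε ∈ Icc (0 : ℝ) 1) (f : H) :
    riskGradient L (contaminate Q z ε) lam f = riskGradient L Q lam f +
      ε • (deriv (L z.2) (f z.1) • RKHS.kerFun H z.1 1 -
        ∫ p, deriv (L p.2) (f p.1) • RKHS.kerFun H p.1 1 ∂Q) := by
  rw [riskGradient, contaminate, integral_add_measure, integral_smul_measure,
    integral_smul_measure, integral_dirac' _ _ (stronglyMeasurable_deriv_smul hL hΦ f),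
    ENNReal.toReal_ofReal hε.1, ENNReal.toReal_ofReal (sub_nonneg.2 hε.2), riskGradient,
    sub_smul, smul_sub, one_smul]
  · abel
  · exact (integrable_deriv_smul hL hΦ f).smul_measure ENNReal.ofReal_ne_top
  · exact (integrable_deriv_smul hL hΦ f).smul_measure ENNReal.ofReal_ne_top

/-- The influence function of the support vector machine exists and is bounded uniformly in the
point of contamination. -/
theorem exists_hasInfluenceFunction_svm [IsProbabilityMeasure Q] (hL : SmoothConvexLoss L M₁ M₂)
    (hΦ : BoundedFeature (A := A) H κ) (hlam : 0 < lam) (z : A × Y) :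
    ∃ g : H, HasInfluenceFunction (svm H L lam) Q z g ∧ ‖g‖ ≤ 2 * (M₁ * κ) / (2 * lam) := by
  obtain ⟨T, hT⟩ := exists_hasFDerivAt_riskGradient (lam := lam) (Q := Q) hL hΦ (svm H L lam Q)
  -- With `lam = 0` the gradient is the bare integral, so this yields the continuity of the integral
  -- term of `D`.
  obtain ⟨T', hT'⟩ := exists_hasFDerivAt_riskGradient (lam := 0) (Q := Q) hL hΦ (svm H L lam Q)
  refine exists_tendsto_perturbed_zero (mul_pos two_pos hlam)
    (le_inner_riskGradient_sub (Q := Q) hL hΦ) (riskGradient_svm hL hΦ hlam) hT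
    (D := fun f => deriv (L z.2) (f z.1) • RKHS.kerFun H z.1 1 -
        ∫ p, deriv (L p.2) (f p.1) • RKHS.kerFun H p.1 1 ∂Q) ?_ (fun f => ?_) ?_
  · refine (hasFDerivAt_deriv_smul hL z _).continuousAt.sub ?_
    have h0 : riskGradient L Q 0 = fun f : H =>
        ∫ p, deriv (L p.2) (f p.1) • RKHS.kerFun H p.1 1 ∂Q := by
      funext f; simp [riskGradient]
    exact h0 ▸ hT'.continuousAt
  · rw [two_mul]
    refine (norm_sub_le _ _).trans (add_le_add (norm_deriv_smul_le hL hΦ f z) ?_)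
    simpa using norm_integral_le_of_norm_le_const (μ := Q)
      (Eventually.of_forall (norm_deriv_smul_le hL hΦ f))
  · filter_upwards [Ioc_mem_nhdsGT one_pos] with ε hε
    have hε' : ε ∈ Icc (0 : ℝ) 1 := ⟨hε.1.le, hε.2⟩
    have := isProbabilityMeasure_contaminate Q z hε'
    rw [← riskGradient_contaminate hL hΦ z hε']
    exact riskGradient_svm hL hΦ hlam

end Gradient

/-! ### From a continuous bounded kernel to its feature map. -/

section Kernel

theorem scalarKernel_eq_inner {A H : Type*} [NormedAddCommGroup H] [InnerProductSpace ℝ H]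
    [CompleteSpace H] [RKHS ℝ H A ℝ] (x y : A) :
    scalarKernel H x y = ⟪RKHS.kerFun H x 1, RKHS.kerFun H y 1⟫ := by
  rw [inner_kerFun_one, RKHS.kerFun_apply, scalarKernel]

theorem norm_kerFun_one_eq {A H : Type*} [NormedAddCommGroup H] [InnerProductSpace ℝ H]
    [CompleteSpace H] [RKHS ℝ H A ℝ] (x : A) :
    ‖RKHS.kerFun H x 1‖ = √(scalarKernel H x x) := by
  rw [norm_eq_sqrt_real_inner, scalarKernel_eq_inner]

/-- Expanding `‖φ y - φ x‖²` expresses the distance through the kernel. -/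
theorem continuous_of_continuous_inner {A E : Type*} [TopologicalSpace A] [NormedAddCommGroup E]
    [InnerProductSpace ℝ E] {φ : A → E} (h : Continuous fun p : A × A => ⟪φ p.1, φ p.2⟫) :
    Continuous φ := by
  refine continuous_iff_continuousAt.2 fun x => tendsto_iff_norm_sub_tendsto_zero.2 ?_
  have h1 : ∀ y : A, ‖φ y - φ x‖ = √(⟪φ y, φ y⟫ - 2 * ⟪φ y, φ x⟫ + ⟪φ x, φ x⟫) := fun y => by
    rw [real_inner_self_eq_norm_sq, real_inner_self_eq_norm_sq, ← norm_sub_sq_real,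
      Real.sqrt_sq (norm_nonneg _)]
  have h2 : Continuous fun y : A => √(⟪φ y, φ y⟫ - 2 * ⟪φ y, φ x⟫ + ⟪φ x, φ x⟫) := by
    have ha : Continuous fun y : A => ⟪φ y, φ y⟫ := h.comp (continuous_id.prodMk continuous_id)
    have hb : Continuous fun y : A => ⟪φ y, φ x⟫ := h.comp (continuous_id.prodMk continuous_const)
    exact ((ha.sub (hb.const_mul 2)).add_const _).sqrt
  have h3 := h2.tendsto x
  rw [← h1, sub_self, norm_zero] at h3
  exact h3.congr fun y => (h1 y).symm

theorem continuous_kerFun_one {A H : Type*} [TopologicalSpace A] [NormedAddCommGroup H]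
    [InnerProductSpace ℝ H] [CompleteSpace H] [RKHS ℝ H A ℝ]
    (hk : Continuous fun p : A × A => scalarKernel H p.1 p.2) :
    Continuous fun x : A => RKHS.kerFun H x 1 :=
  continuous_of_continuous_inner (hk.congr fun p => scalarKernel_eq_inner p.1 p.2)

theorem exists_boundedFeature {A H : Type*} [TopologicalSpace A] [SecondCountableTopology A]
    [MeasurableSpace A] [OpensMeasurableSpace A] [NormedAddCommGroup H] [InnerProductSpace ℝ H]
    [CompleteSpace H] [RKHS ℝ H A ℝ]
    (hk : Continuous fun p : A × A => scalarKernel H p.1 p.2)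
    (hb : BddAbove (Set.range fun x : A => √(scalarKernel H x x))) :
    ∃ κ, BoundedFeature (A := A) H κ := by
  obtain ⟨κ, hκ⟩ := hb
  -- On an empty region the upper bound `κ` may be negative. Second countability turns continuity
  -- into strong measurability.
  refine ⟨max κ 0, (continuous_kerFun_one hk).stronglyMeasurable, le_max_right _ _, fun x => ?_⟩
  rw [norm_kerFun_one_eq]
  exact (hκ (mem_range_self x)).trans (le_max_left _ _)

end Kernel

/-! ### Weighted embedding of a local RKHS into `L^∞`. -/

section Embedding

variable {X : Type*} [MeasurableSpace X] {A : Set X} {w : X → ℝ}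
  {H : Type*} [NormedAddCommGroup H] [InnerProductSpace ℝ H] [CompleteSpace H] [RKHS ℝ H A ℝ]
  {κ : ℝ} {μ : Measure X}

omit [MeasurableSpace X] in
theorem extendZero_of_mem {f : A → ℝ} {x : X} (hx : x ∈ A) : extendZero f x = f ⟨x, hx⟩ :=
  dif_pos hx

omit [MeasurableSpace X] in
theorem extendZero_of_notMem {f : A → ℝ} {x : X} (hx : x ∉ A) : extendZero f x = 0 :=
  dif_neg hx

theorem measurable_extendZero (hA : MeasurableSet A) {f : A → ℝ} (hf : Measurable f) :
    Measurable (extendZero f) := by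
  classical
  exact Measurable.dite (g := fun _ => (0 : ℝ)) hf measurable_const hA

omit [MeasurableSpace X] [CompleteSpace H] in
theorem extendZero_coe_add (f g : H) (x : X) :
    extendZero (⇑(f + g)) x = extendZero (f : A → ℝ) x + extendZero (g : A → ℝ) x := by
  by_cases hx : x ∈ A <;> simp [extendZero, hx]

omit [MeasurableSpace X] [CompleteSpace H] in
theorem extendZero_coe_smul (c : ℝ) (f : H) (x : X) :
    extendZero (⇑(c • f)) x = c * extendZero (f : A → ℝ) x := by
  by_cases hx : x ∈ A <;> simp [extendZero, hx]

theorem abs_mul_extendZero_le (hΦ : BoundedFeature (A := A) H κ) (hw1 : ∀ x, |w x| ≤ 1) (f : H)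
    (x : X) : |w x * extendZero (f : A → ℝ) x| ≤ κ * ‖f‖ := by
  rw [abs_mul]
  have h0 : 0 ≤ κ * ‖f‖ := mul_nonneg hΦ.nonneg (norm_nonneg _)
  refine (mul_le_of_le_one_left (abs_nonneg _) (hw1 x)).trans ?_
  by_cases hx : x ∈ A
  · rw [extendZero_of_mem hx]; exact hΦ.abs_apply_le f _
  · rwa [extendZero_of_notMem hx, abs_zero]

theorem memLp_mul_extendZero (hA : MeasurableSet A) (hΦ : BoundedFeature (A := A) H κ)
    (hw : Measurable w) (hw1 : ∀ x, |w x| ≤ 1) (μ : Measure X) (f : H) :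
    MemLp (fun x => w x * extendZero (f : A → ℝ) x) ∞ μ :=
  memLp_top_of_bound
    (hw.mul (measurable_extendZero hA (hΦ.measurable_coe f))).aestronglyMeasurable (κ * ‖f‖)
    (Eventually.of_forall (abs_mul_extendZero_le hΦ hw1 f))

/-- The continuous linear map `f ↦ w f` from an RKHS on the region `A` to `L^∞(μ)`. -/
noncomputable def weightedEmbedding (hA : MeasurableSet A) (hΦ : BoundedFeature (A := A) H κ)
    (hw : Measurable w) (hw1 : ∀ x, |w x| ≤ 1) (μ : Measure X) [IsFiniteMeasure μ] :
    H →L[ℝ] Lp ℝ ∞ μ :=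
  LinearMap.mkContinuous
    { toFun := fun f => (memLp_mul_extendZero hA hΦ hw hw1 μ f).toLp _
      map_add' := fun f g => by
        rw [← MemLp.toLp_add]
        refine MemLp.toLp_congr _ _ (Eventually.of_forall fun x => ?_)
        simp only [extendZero_coe_add, mul_add, Pi.add_apply]
      map_smul' := fun c f => by
        rw [RingHom.id_apply, ← MemLp.toLp_const_smul]
        refine MemLp.toLp_congr _ _ (Eventually.of_forall fun x => ?_)
        simp only [extendZero_coe_smul, Pi.smul_apply, smul_eq_mul]
        ring } κ fun f => by
    have h := Lp.norm_le_of_ae_bound (f := (memLp_mul_extendZero hA hΦ hw hw1 μ f).toLp _)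
      (mul_nonneg hΦ.nonneg (norm_nonneg f)) (by
        filter_upwards [(memLp_mul_extendZero hA hΦ hw hw1 μ f).coeFn_toLp] with x hx
        rw [hx]
        exact abs_mul_extendZero_le hΦ hw1 f x)
    simpa using h

variable (hA : MeasurableSet A) (hΦ : BoundedFeature (A := A) H κ)
    (hw : Measurable w) (hw1 : ∀ x, |w x| ≤ 1) [IsFiniteMeasure μ]

theorem coeFn_weightedEmbedding (f : H) :
    weightedEmbedding hA hΦ hw hw1 μ f =ᵐ[μ] fun x => w x * extendZero (f : A → ℝ) x :=
  (memLp_mul_extendZero hA hΦ hw hw1 μ f).coeFn_toLp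

theorem norm_weightedEmbedding_le (f : H) : ‖weightedEmbedding hA hΦ hw hw1 μ f‖ ≤ κ * ‖f‖ :=
  ((weightedEmbedding hA hΦ hw hw1 μ).le_opNorm f).trans
    (mul_le_mul_of_nonneg_right (LinearMap.mkContinuous_norm_le _ hΦ.nonneg _) (norm_nonneg _))

/-- Extended functions vanish off `A`; hence nothing chosen on a null region is visible in `L^∞`. -/
theorem weightedEmbedding_eq_zero (h0 : μ A = 0) (f : H) :
    weightedEmbedding hA hΦ hw hw1 μ f = 0 := by
  refine Lp.ext ?_
  filter_upwards [coeFn_weightedEmbedding (μ := μ) hA hΦ hw hw1 f, Lp.coeFn_zero ℝ ∞ μ,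
    measure_eq_zero_iff_ae_notMem.1 h0] with x h1 h2 h3
  rw [h1, h2, extendZero_of_notMem h3, mul_zero, Pi.zero_apply]

end Embedding

/-! ### Regional distributions of mixtures. -/

section Regional

variable {X Y : Type*} [MeasurableSpace X] [MeasurableSpace Y] {A : Set X}
  {P : Measure (X × Y)}

theorem measurableEmbedding_region (hA : MeasurableSet A) :
    MeasurableEmbedding fun p : A × Y => ((p.1 : X), p.2) :=
  (MeasurableEmbedding.subtype_coe hA).prodMap MeasurableEmbedding.id

theorem regional_apply (hA : MeasurableSet A) (P : Measure (X × Y)) (s : Set (A × Y)) :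
    regional A P s =
      (P (A ×ˢ univ))⁻¹ * P ((fun p : A × Y => ((p.1 : X), p.2)) '' s) := by
  rw [regional, Measure.smul_apply, (measurableEmbedding_region hA).comap_apply, smul_eq_mul]

theorem isProbabilityMeasure_regional [IsFiniteMeasure P] (hA : MeasurableSet A)
    (h0 : P (A ×ˢ univ) ≠ 0) : IsProbabilityMeasure (regional A P) := by
  refine ⟨?_⟩
  have h : (fun p : A × Y => ((p.1 : X), p.2)) '' univ = A ×ˢ univ := by
    ext ⟨x, y⟩; simp
  rw [regional_apply hA, h, ENNReal.inv_mul_cancel h0 (measure_ne_top _ _)]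

theorem fst_apply_region (hA : MeasurableSet A) : P.fst A = P (A ×ˢ univ) := by
  rw [Measure.fst_apply hA, prod_univ]

theorem contaminate_apply {M : Type*} [MeasurableSpace M] (P : Measure M) (z : M) (ε : ℝ)
    (s : Set M) : contaminate P z ε s =
      ENNReal.ofReal (1 - ε) * P s + ENNReal.ofReal ε * Measure.dirac z s := by
  simp [contaminate]

theorem contaminate_apply_ne_zero {M : Type*} [MeasurableSpace M] {P : Measure M} (z : M) {ε : ℝ}
    (hε : ε < 1) {s : Set M} (hs : P s ≠ 0) : contaminate P z ε s ≠ 0 := by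
  rw [contaminate_apply]
  simp [hs, hε]

/-- On the region the mixture is `(1 - ε) P`, and normalization cancels the factor, nonzero as `ε <
1`. -/
theorem regional_contaminate_of_notMem (hA : MeasurableSet A) {z : X × Y}
    (hz : z.1 ∉ A) {ε : ℝ} (hε : ε < 1) :
    regional A (contaminate P z ε) = regional A P := by
  ext s hs
  have h1 : ∀ t ⊆ A ×ˢ (univ : Set Y), MeasurableSet t →
      contaminate P z ε t = ENNReal.ofReal (1 - ε) * P t := fun t ht hm => by
    have : z ∉ t := fun h => hz (ht h).1
    rw [contaminate_apply, Measure.dirac_apply' _ hm, indicator_of_notMem this, mul_zero, add_zero]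
  have hc : ENNReal.ofReal (1 - ε) ≠ 0 := by simpa using hε
  rw [regional_apply hA, regional_apply hA, h1 _ Subset.rfl (hA.prod MeasurableSet.univ), h1 _ ?_
    ((measurableEmbedding_region hA).measurableSet_image.2 hs),
    ENNReal.mul_inv (Or.inl hc) (Or.inl ENNReal.ofReal_ne_top), mul_mul_mul_comm,
    mul_comm _ (ENNReal.ofReal _), mul_comm (ENNReal.ofReal _),
    ENNReal.inv_mul_cancel hc ENNReal.ofReal_ne_top, one_mul]
  rintro _ ⟨p, -, rfl⟩
  exact ⟨p.1.2, mem_univ _⟩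

/-- The regional distribution of a mixture is a mixture of the regional distribution, with a
larger weight on the point. -/
theorem regional_contaminate_of_mem [IsFiniteMeasure P] (hA : MeasurableSet A) {z : X × Y}
    (hz : z.1 ∈ A) (h0 : P (A ×ˢ univ) ≠ 0) {ε : ℝ} (hε : ε ∈ Ico (0 : ℝ) 1) :
    regional A (contaminate P z ε) = contaminate (regional A P) (⟨z.1, hz⟩, z.2)
      (ε / ((1 - ε) * P.real (A ×ˢ univ) + ε)) := by
  ext s hs
  have hp : 0 < P.real (A ×ˢ univ) := ENNReal.toReal_pos h0 (measure_ne_top _ _)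
  set p : ℝ := P.real (A ×ˢ univ)
  have hPp : P (A ×ˢ univ) = ENNReal.ofReal p := (ofReal_measureReal).symm
  have hε1 : 0 < 1 - ε := sub_pos.2 hε.2
  have hq : 0 < (1 - ε) * p + ε := add_pos_of_pos_of_nonneg (mul_pos hε1 hp) hε.1
  -- The mass of the region under the mixture; the weights match since `1 - ε / q = (1 - ε) p / q`.
  set q : ℝ := (1 - ε) * p + ε with hq_def
  have hd : Measure.dirac z ((fun p : A × Y => ((p.1 : X), p.2)) '' s) =
      Measure.dirac ((⟨z.1, hz⟩, z.2) : A × Y) s := by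
    rw [Measure.dirac_apply' _ ((measurableEmbedding_region hA).measurableSet_image.2 hs),
      Measure.dirac_apply' _ hs]
    have := (measurableEmbedding_region (Y := Y) hA).injective.mem_set_image
      (s := s) (a := (⟨z.1, hz⟩, z.2))
    by_cases h : ((⟨z.1, hz⟩, z.2) : A × Y) ∈ s
    · rw [indicator_of_mem h, indicator_of_mem (this.2 h)]; rfl
    · rw [indicator_of_notMem h, indicator_of_notMem (mt this.1 h)]
  have hq' : contaminate P z ε (A ×ˢ univ) = ENNReal.ofReal q := by
    rw [contaminate_apply, hPp, Measure.dirac_apply_of_mem (show z ∈ A ×ˢ univ from ⟨hz, trivial⟩),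
      mul_one, ← ENNReal.ofReal_mul hε1.le, ← ENNReal.ofReal_add (by positivity) hε.1]
  rw [regional_apply hA, hq', contaminate_apply, contaminate_apply, regional_apply hA, hd, hPp,
    ← ENNReal.ofReal_inv_of_pos hq, ← ENNReal.ofReal_inv_of_pos hp, mul_add, ← mul_assoc,
    ← mul_assoc, ← mul_assoc, ← ENNReal.ofReal_mul (by positivity),
    ← ENNReal.ofReal_mul (by positivity), ← ENNReal.ofReal_mul, inv_mul_eq_div, inv_mul_eq_div]
  · congr 3
    field_simp
    linarith
  · rw [sub_nonneg, div_le_one hq]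
    have : 0 ≤ (1 - ε) * p := by positivity
    linarith

end Regional

/-! ### Limits of the embedded local difference quotients. -/

section Limits

/-- With `η = ε / ((1 - ε) p + ε)`, write `ε⁻¹ = (η / ε) η⁻¹`; here `η ↓ 0` and `η / ε → 1 / p`. -/
theorem HasInfluenceFunction.tendsto_reweighted {M E : Type*} [MeasurableSpace M]
    [NormedAddCommGroup E] [NormedSpace ℝ E] {S : Measure M → E} {P : Measure M} {z : M} {g : E}
    (h : HasInfluenceFunction S P z g) {p : ℝ} (hp : 0 < p) :
    Tendsto (fun ε : ℝ => ε⁻¹ • (S (contaminate P z (ε / ((1 - ε) * p + ε))) - S P)) (𝓝[>] 0)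
      (𝓝 (p⁻¹ • g)) := by
  have hq : Tendsto (fun ε : ℝ => (1 - ε) * p + ε) (𝓝[>] 0) (𝓝 p) := by
    have : Continuous fun ε : ℝ => (1 - ε) * p + ε := by fun_prop
    have := this.tendsto 0
    simp only [sub_zero, one_mul, add_zero] at this
    exact this.mono_left nhdsWithin_le_nhds
  have hpos : ∀ᶠ ε in 𝓝[>] (0 : ℝ), 0 < ε ∧ 0 < (1 - ε) * p + ε := by
    filter_upwards [self_mem_nhdsWithin, hq.eventually (lt_mem_nhds hp)] with ε h1 h2 using ⟨h1, h2⟩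
  have hη : Tendsto (fun ε : ℝ => ε / ((1 - ε) * p + ε)) (𝓝[>] 0) (𝓝[>] 0) := by
    refine tendsto_nhdsWithin_iff.2 ⟨?_, hpos.mono fun ε h => div_pos h.1 h.2⟩
    have : Tendsto (fun ε : ℝ => ε) (𝓝[>] 0) (𝓝 0) := nhdsWithin_le_nhds
    simpa only [zero_div, Pi.div_def] using this.div hq hp.ne'
  refine ((hq.inv₀ hp.ne').smul (Tendsto.comp h hη)).congr' ?_
  filter_upwards [hpos] with ε hε
  have h1 := hε.1.ne'
  have h2 := hε.2.ne'
  rw [Function.comp_apply, smul_smul, inv_div, inv_mul_eq_div, div_div_cancel_left' h2]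

variable {X Y : Type*} [MeasurableSpace X] [MeasurableSpace Y] {A : Set X} {L : Y → ℝ → ℝ}
  {w : X → ℝ} {M₁ M₂ κ lam : ℝ} {P : Measure (X × Y)} [IsProbabilityMeasure P]
  {H : Type*} [NormedAddCommGroup H] [InnerProductSpace ℝ H] [CompleteSpace H] [RKHS ℝ H A ℝ]

theorem exists_isLocalInfluenceFunction (hL : SmoothConvexLoss L M₁ M₂) (hA : MeasurableSet A)
    (hΦ : BoundedFeature (A := A) H κ) (hM₁ : 0 ≤ M₁) (hlam : 0 < lam) (P : Measure (X × Y))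
    [IsProbabilityMeasure P] (z : X × Y) :
    ∃ g : H, IsLocalInfluenceFunction L lam P z g ∧ ‖g‖ ≤ 2 * (M₁ * κ) / (2 * lam) := by
  by_cases h : z.1 ∈ A ∧ P (A ×ˢ univ) ≠ 0
  · have := isProbabilityMeasure_regional hA h.2
    obtain ⟨g, hg, hb⟩ := exists_hasInfluenceFunction_svm (Q := regional A P) hL hΦ hlam
      (⟨z.1, h.1⟩, z.2)
    exact ⟨g, ⟨fun _ _ => hg, fun h' => by tauto⟩, hb⟩
  · refine ⟨0, ⟨fun h1 h2 => absurd ⟨h1, h2⟩ h, fun _ => rfl⟩, ?_⟩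
    have := hΦ.nonneg
    rw [norm_zero]
    positivity

variable (hA : MeasurableSet A) (hΦ : BoundedFeature (A := A) H κ)
    (hw : Measurable w) (hw1 : ∀ x, |w x| ≤ 1) {z : X × Y} {g : H}

theorem tendsto_weightedEmbedding_regionalContaminate
    (hg : IsLocalInfluenceFunction L lam P z g) :
    Tendsto (fun ε : ℝ => ε⁻¹ •
      (weightedEmbedding hA hΦ hw hw1 P.fst (svm H L lam (regionalContaminate A P z ε)) -
        weightedEmbedding hA hΦ hw hw1 P.fst (svm H L lam (regional A P))))
      (𝓝[>] 0) (𝓝 (weightedEmbedding hA hΦ hw hw1 P.fst g)) := by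
  by_cases h0 : P (A ×ˢ univ) = 0
  · simp [weightedEmbedding_eq_zero hA hΦ hw hw1 ((fst_apply_region hA).trans h0)]
  by_cases hz : z.1 ∈ A
  · simp only [← map_sub, ← map_smul]
    refine ((weightedEmbedding hA hΦ hw hw1 P.fst).continuous.tendsto g).comp ?_
    simp only [regionalContaminate, dif_pos hz]
    exact hg.1 hz h0
  · simp [regionalContaminate, dif_neg hz, hg.2 (Or.inl hz)]

theorem tendsto_weightedEmbedding_regional_contaminate
    (hg : IsLocalInfluenceFunction L lam P z g) :
    Tendsto (fun ε : ℝ => ε⁻¹ •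
      (weightedEmbedding hA hΦ hw hw1 P.fst (svm H L lam (regional A (contaminate P z ε))) -
        weightedEmbedding hA hΦ hw hw1 P.fst (svm H L lam (regional A P))))
      (𝓝[>] 0) (𝓝 (weightedEmbedding hA hΦ hw hw1 P.fst ((P.real (A ×ˢ univ))⁻¹ • g))) := by
  by_cases h0 : P (A ×ˢ univ) = 0
  · simp [weightedEmbedding_eq_zero hA hΦ hw hw1 ((fst_apply_region hA).trans h0)]
  by_cases hz : z.1 ∈ A
  · simp only [← map_sub, ← map_smul]
    refine ((weightedEmbedding hA hΦ hw hw1 P.fst).continuous.tendsto _).comp ?_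
    refine ((hg.1 hz h0).tendsto_reweighted
      (ENNReal.toReal_pos h0 (measure_ne_top _ _))).congr' ?_
    filter_upwards [Ioo_mem_nhdsGT one_pos] with ε hε
    rw [regional_contaminate_of_mem hA hz h0 ⟨hε.1.le, hε.2⟩, Measure.real]
  · rw [hg.2 (Or.inl hz), smul_zero, map_zero]
    refine tendsto_const_nhds.congr' ?_
    filter_upwards [Ioo_mem_nhdsGT one_pos] with ε hε
    rw [regional_contaminate_of_notMem hA hz hε.2, sub_self, smul_zero]

end Limits

/-! ### The composed predictor as a sum of embedded local SVMs. -/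

section Compose

theorem memLp_and_linftyClass_eq {X : Type*} [MeasurableSpace X] {μ : Measure X} {f : X → ℝ}
    {G : Lp ℝ ∞ μ} (h : G =ᵐ[μ] f) : MemLp f ∞ μ ∧ linftyClass μ f = G := by
  have hf : MemLp f ∞ μ := (memLp_congr_ae h).1 (Lp.memLp G)
  refine ⟨hf, ?_⟩
  rw [linftyClass, dif_pos hf]
  exact Lp.ext (hf.coeFn_toLp.trans h.symm)

variable {X Y : Type*} [MeasurableSpace X] [MeasurableSpace Y]
  {B : ℕ} {R : Fin B → Set X} {H : Fin B → Type*}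
  [∀ b, NormedAddCommGroup (H b)] [∀ b, InnerProductSpace ℝ (H b)] [∀ b, CompleteSpace (H b)]
  [∀ b, RKHS ℝ (H b) (R b) ℝ] {L : Y → ℝ → ℝ} {lam κ : Fin B → ℝ} {w : Fin B → X → ℝ}
  {μ : Measure X} [IsFiniteMeasure μ]
  (hR : ∀ b, MeasurableSet (R b)) (hΦ : ∀ b, BoundedFeature (A := R b) (H b) (κ b))
  (hw : ∀ b, Measurable (w b)) (hw1 : ∀ b x, |w b x| ≤ 1)

theorem coeFn_sum_weightedEmbedding (f : ∀ b, H b) :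
    (∑ b, weightedEmbedding (hR b) (hΦ b) (hw b) (hw1 b) μ (f b) : Lp ℝ ∞ μ) =ᵐ[μ]
      fun x => ∑ b, w b x * extendZero (⇑(f b)) x := by
  have h := fun b => coeFn_weightedEmbedding (μ := μ) (hR b) (hΦ b) (hw b) (hw1 b) (f b)
  filter_upwards [ae_all_iff.2 h, Lp.coeFn_finsetSum (E := ℝ) (p := ∞) (μ := μ) Finset.univ
    fun b => weightedEmbedding (hR b) (hΦ b) (hw b) (hw1 b) μ (f b)] with x h1 h2
  rw [h2, Finset.sum_apply]
  exact Finset.sum_congr rfl fun b _ => h1 b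

/-- Almost every point avoids all null regions, so only regions of positive mass need a probability
measure, and `v` does not matter. -/
theorem compose_ae_eq (v : ∀ b, R b → ℝ) {Q : ∀ b, Measure (R b × Y)}
    (hQ : ∀ b, μ (R b) ≠ 0 → IsProbabilityMeasure (Q b)) :
    (∑ b, weightedEmbedding (hR b) (hΦ b) (hw b) (hw1 b) μ (svm (H b) L (lam b) (Q b)) :
      Lp ℝ ∞ μ) =ᵐ[μ] compose H L lam w v Q := by
  refine (coeFn_sum_weightedEmbedding hR hΦ hw hw1 _).trans ?_
  have h : ∀ b, ∀ᵐ x ∂μ, μ (R b) = 0 → x ∉ R b := fun b => by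
    by_cases h0 : μ (R b) = 0
    · filter_upwards [measure_eq_zero_iff_ae_notMem.1 h0] with x hx _ using hx
    · exact Eventually.of_forall fun x h => absurd h h0
  filter_upwards [ae_all_iff.2 h] with x hx
  refine Finset.sum_congr rfl fun b _ => ?_
  by_cases h0 : μ (R b) = 0
  · rw [extendZero_of_notMem (hx b h0), extendZero_of_notMem (hx b h0)]
  · rw [if_pos (hQ b h0)]

end Compose

theorem exists_smoothConvexLoss {Y : Type*} [MeasurableSpace Y] {L : Y → ℝ → ℝ}
    (hLmeas : Measurable (Function.uncurry L)) (hLconv : ∀ y, ConvexOn ℝ Set.univ (L y))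
    (hLdiff : ∀ y, ContDiff ℝ 2 (L y)) (hL1fin : ⨆ y, ⨆ t, ‖deriv (L y) t‖ₑ < ∞)
    (hL2fin : ⨆ y, ⨆ t, ‖deriv (deriv (L y)) t‖ₑ < ∞) :
    ∃ M₁ M₂, 0 ≤ M₁ ∧ SmoothConvexLoss L M₁ M₂ := by
  have key : ∀ F : Y → ℝ → ℝ, ⨆ y, ⨆ t, ‖F y t‖ₑ < ∞ → ∀ y t,
      |F y t| ≤ (⨆ y, ⨆ t, ‖F y t‖ₑ).toReal := fun F hF y t => by
    have h : ‖F y t‖ₑ ≤ ⨆ y, ⨆ t, ‖F y t‖ₑ := le_iSup₂ (f := fun y t => ‖F y t‖ₑ) y t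
    simpa using ENNReal.toReal_mono hF.ne h
  exact ⟨_, _, ENNReal.toReal_nonneg, hLmeas, hLdiff, hLconv, key _ hL1fin, key _ hL2fin⟩

end LocalSVM

/-! ### Assembly over the regions. -/

theorem theorem3p3
    {X : Type*} [MetricSpace X] [MeasurableSpace X] [BorelSpace X]
    -- the output space
    (Y : Set ℝ) (hY : IsClosed Y)
    -- the regions: complete separable metric spaces
    (B : ℕ) (R : Fin B → Set X)
    (hRcomplete : ∀ b, IsComplete (R b))
    (hRsep : ∀ b, TopologicalSpace.IsSeparable (R b))
    -- the weights
    (w : Fin B → X → ℝ) (hwmeas : ∀ b, Measurable (w b))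
    (hw01 : ∀ b x, w b x ∈ Set.Icc (0 : ℝ) 1)
    (hW1 : ∀ x, ∑ b, w b x = 1)
    (hW2 : ∀ b, ∀ x ∉ R b, w b x = 0)
    -- the RKHSs, with bounded continuous kernels
    (H : Fin B → Type*) [∀ b, NormedAddCommGroup (H b)] [∀ b, InnerProductSpace ℝ (H b)]
    [∀ b, CompleteSpace (H b)] [∀ b, RKHS ℝ (H b) (R b) ℝ]
    (hkbdd : ∀ b, BddAbove
      (Set.range fun x : R b => Real.sqrt (LocalSVM.scalarKernel (H b) x x)))
    (hkcont : ∀ b, Continuous fun p : R b × R b => LocalSVM.scalarKernel (H b) p.1 p.2)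
    -- the loss
    (L : Y → ℝ → ℝ) (hLmeas : Measurable (Function.uncurry L)) (hLnonneg : ∀ y t, 0 ≤ L y t)
    (hLconv : ∀ y, ConvexOn ℝ Set.univ (L y))
    (hLlip : ∃ c : NNReal, ∀ y, LipschitzWith c (L y))
    (hLdiff : ∀ y, ContDiff ℝ 2 (L y))
    (hL1pos : 0 < ⨆ y, ⨆ t, ‖deriv (L y) t‖ₑ)
    (hL1fin : ⨆ y, ⨆ t, ‖deriv (L y) t‖ₑ < ∞)
    (hL2fin : ⨆ y, ⨆ t, ‖deriv (deriv (L y)) t‖ₑ < ∞)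
    -- the regularization parameters
    (lam : Fin B → ℝ) (hlam : ∀ b, 0 < lam b)
    -- the arbitrary measurable predictors used on null regions
    (u : Measure (X × Y) → ∀ b, R b → ℝ) (hu : ∀ Q b, Measurable (u Q b))
    -- the distribution
    (P : Measure (X × Y)) [IsProbabilityMeasure P] :
    -- the local SVMs are well defined
    (∀ b, ∀ Q : Measure (R b × Y), IsProbabilityMeasure Q →
      ∃! f : H b, LocalSVM.IsSVM L Q (lam b) f) ∧
    -- there is a bound that does not depend on `z`
    ∃ C : ℝ, ∀ z : X × Y,
      -- the local influence functions exist
      ∃ g : ∀ b, H b,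
        (∀ b, LocalSVM.IsLocalInfluenceFunction L (lam b) P z (g b)) ∧
        -- the composed influence function for the regionwise mixtures
        (∀ ε ∈ Set.Ico (0 : ℝ) 1,
          MemLp (LocalSVM.regionalCompPredictor H L lam w u P z ε) ∞ P.fst) ∧
        (∃ G : Lp ℝ ∞ P.fst,
          Tendsto (fun ε : ℝ => ε⁻¹ •
              (LocalSVM.linftyClass P.fst (LocalSVM.regionalCompPredictor H L lam w u P z ε) -
                LocalSVM.linftyClass P.fst (LocalSVM.compPredictor H L lam w u P)))
            (𝓝[>] 0) (𝓝 G) ∧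
          (G =ᵐ[P.fst] fun x => ∑ b, w b x * LocalSVM.extendZero (⇑(g b)) x) ∧
          ‖G‖ ≤ C) ∧
        -- the composed influence function for the mixture `(1 - ε) P + ε δ_z` itself
        (∀ ε ∈ Set.Ico (0 : ℝ) 1,
          MemLp (LocalSVM.compPredictor H L lam w u (LocalSVM.contaminate P z ε)) ∞ P.fst) ∧
        (∃ G : Lp ℝ ∞ P.fst,
          LocalSVM.HasInfluenceFunction
            (fun Q => LocalSVM.linftyClass P.fst (LocalSVM.compPredictor H L lam w u Q))
            P z G ∧
          (G =ᵐ[P.fst] fun x => ∑ b,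
            (P.real (R b ×ˢ Set.univ))⁻¹ * (w b x * LocalSVM.extendZero (⇑(g b)) x)) ∧
          ‖G‖ ≤ C) := by
  obtain ⟨M₁, M₂, hM₁, hL⟩ :=
    LocalSVM.exists_smoothConvexLoss hLmeas hLconv hLdiff hL1fin hL2fin
  -- Completeness makes a region closed, hence Borel.
  have hR : ∀ b, MeasurableSet (R b) := fun b => (hRcomplete b).isClosed.measurableSet
  have hΦ : ∀ b, ∃ κ, LocalSVM.BoundedFeature (A := R b) (H b) κ := fun b => by
    have := (hRsep b).separableSpace
    have := UniformSpace.secondCountable_of_separable (R b)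
    exact LocalSVM.exists_boundedFeature (hkcont b) (hkbdd b)
  choose κ hΦ using hΦ
  have hw1 : ∀ b x, |w b x| ≤ 1 := fun b x => by
    rw [abs_of_nonneg (hw01 b x).1]
    exact (hw01 b x).2
  refine ⟨fun b Q _ => LocalSVM.existsUnique_isSVM hL (hΦ b) (hlam b), ?_⟩
  -- Norm bound of the embedding times that of the local influence function.
  set K : Fin B → ℝ := fun b => κ b * (2 * (M₁ * κ b) / (2 * lam b)) with hK
  have hK0 : ∀ b, 0 ≤ K b := fun b => by
    have := (hΦ b).nonneg
    have := hlam b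
    positivity
  -- On a null region this is `0⁻¹ = 0`, so sums over all `b` reduce to regions of positive mass.
  set p : Fin B → ℝ := fun b => (P.real (R b ×ˢ Set.univ))⁻¹ with hp
  have hp0 : ∀ b, 0 ≤ p b := fun b => inv_nonneg.2 measureReal_nonneg
  -- Dominates both `∑ b, K b` and `∑ b, p b * K b`, the bounds for the two kinds of contamination.
  refine ⟨∑ b, (1 + p b) * K b, fun z => ?_⟩
  choose g hg hgK using fun b =>
    LocalSVM.exists_isLocalInfluenceFunction hL (hR b) (hΦ b) hM₁ (hlam b) P z
  set J := fun b => LocalSVM.weightedEmbedding (hR b) (hΦ b) (hwmeas b) (hw1 b) P.fst with hJ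
  have hJK : ∀ b, ‖J b (g b)‖ ≤ K b := fun b =>
    (LocalSVM.norm_weightedEmbedding_le _ _ _ _ _).trans
      (mul_le_mul_of_nonneg_left (hgK b) (hΦ b).nonneg)
  have hne : ∀ b, P.fst (R b) ≠ 0 → P (R b ×ˢ univ) ≠ 0 := fun b h =>
    by rwa [LocalSVM.fst_apply_region (hR b)] at h
  have hprob : ∀ b, P.fst (R b) ≠ 0 → IsProbabilityMeasure (LocalSVM.regional (R b) P) :=
    fun b h => LocalSVM.isProbabilityMeasure_regional (hR b) (hne b h)
  have hcomp := (LocalSVM.memLp_and_linftyClass_eq (LocalSVM.compose_ae_eq (L := L) (lam := lam)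
    hR hΦ hwmeas hw1 (u P) hprob)).2
  have hregional : ∀ ε ∈ Set.Ico (0 : ℝ) 1, ∀ b, P.fst (R b) ≠ 0 →
      IsProbabilityMeasure (LocalSVM.regionalContaminate (R b) P z ε) := fun ε hε b h => by
    have := hprob b h
    unfold LocalSVM.regionalContaminate
    split_ifs
    · exact LocalSVM.isProbabilityMeasure_contaminate _ _ ⟨hε.1, hε.2.le⟩
    · exact this
  have hglobal : ∀ ε ∈ Set.Ico (0 : ℝ) 1, ∀ b, P.fst (R b) ≠ 0 →
      IsProbabilityMeasure (LocalSVM.regional (R b) (LocalSVM.contaminate P z ε)) :=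
    fun ε hε b h => by
    have := LocalSVM.isProbabilityMeasure_contaminate P z ⟨hε.1, hε.2.le⟩
    exact LocalSVM.isProbabilityMeasure_regional (hR b)
      (LocalSVM.contaminate_apply_ne_zero z hε.2 (hne b h))
  have hcompR := fun (ε : ℝ) (hε : ε ∈ Set.Ico (0 : ℝ) 1) => LocalSVM.memLp_and_linftyClass_eq
    (LocalSVM.compose_ae_eq (L := L) (lam := lam) hR hΦ hwmeas hw1
      (u (LocalSVM.contaminate P z ε)) (hregional ε hε))
  have hcompG := fun (ε : ℝ) (hε : ε ∈ Set.Ico (0 : ℝ) 1) => LocalSVM.memLp_and_linftyClass_eq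
    (LocalSVM.compose_ae_eq (L := L) (lam := lam) hR hΦ hwmeas hw1
      (u (LocalSVM.contaminate P z ε)) (hglobal ε hε))
  refine ⟨g, hg, fun ε hε => (hcompR ε hε).1, ⟨∑ b, J b (g b), ?_,
    LocalSVM.coeFn_sum_weightedEmbedding hR hΦ hwmeas hw1 g, ?_⟩,
    fun ε hε => (hcompG ε hε).1, ⟨∑ b, J b (p b • g b), ?_, ?_, ?_⟩⟩
  · refine (tendsto_finsetSum Finset.univ fun b _ =>
      LocalSVM.tendsto_weightedEmbedding_regionalContaminate (hR b) (hΦ b) (hwmeas b) (hw1 b)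
        (hg b)).congr' ?_
    filter_upwards [Ioo_mem_nhdsGT one_pos] with ε hε
    rw [LocalSVM.regionalCompPredictor, LocalSVM.compPredictor, (hcompR ε ⟨hε.1.le, hε.2⟩).2,
      hcomp, ← Finset.smul_sum, Finset.sum_sub_distrib]
  · refine (norm_sum_le _ _).trans (Finset.sum_le_sum fun b _ => (hJK b).trans ?_)
    nlinarith [mul_nonneg (hp0 b) (hK0 b)]
  · refine (tendsto_finsetSum Finset.univ fun b _ =>
      LocalSVM.tendsto_weightedEmbedding_regional_contaminate (hR b) (hΦ b) (hwmeas b) (hw1 b)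
        (hg b)).congr' ?_
    filter_upwards [Ioo_mem_nhdsGT one_pos] with ε hε
    rw [LocalSVM.compPredictor, LocalSVM.compPredictor, (hcompG ε ⟨hε.1.le, hε.2⟩).2,
      hcomp, ← Finset.smul_sum, Finset.sum_sub_distrib]
  · refine (LocalSVM.coeFn_sum_weightedEmbedding hR hΦ hwmeas hw1 fun b => p b • g b).trans
      (Eventually.of_forall fun x => Finset.sum_congr rfl fun b _ => ?_)
    rw [LocalSVM.extendZero_coe_smul]
    ring
  · refine (norm_sum_le _ _).trans (Finset.sum_le_sum fun b _ => ?_)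
    rw [map_smul, norm_smul, Real.norm_eq_abs, abs_of_nonneg (hp0 b)]
    nlinarith [mul_le_mul_of_nonneg_left (hJK b) (hp0 b), hK0 b]
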